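/- Let $d\ge 1$, let $(\mathbf X_n)_{n\in\mathbb N}$ be a sequence of random vectors in $\mathbb R^d$ (each possibly defined on its own probability space), and let $(t_n)_{n\in\mathbb N}$ be a sequence of positive real numbers with $t_n\to+\infty$. For $\xi\in\mathbb R^d$ put $$\theta_n(\xi)=\mathbb E\big[e^{\mathrm i\langle \xi,\mathbf X_n\rangle}\big]\,e^{\frac{t_n\|\xi\|^2}{2}},$$ where $\langle\cdot,\cdot\rangle$ and $\|\cdot\|$ are the Euclidean inner product and norm. Assume that there are real constants $v>0$, $w\ge 2$, $-\frac12<\gamma\le\frac1{w-2}$ (with $\frac1{w-2}=+\infty$ if $w=2$), $K>0$, $K_1$ and $K_2$, all independent of $n$, such that for every $n\in\mathbb N$ and every $\xi\in[-K(t_n)^\gamma,K(t_n)^\gamma]^d$, $$|\theta_n(\xi)-1|\le K_1\,\|\xi\|^v\exp\!\big(K_2\,\|\xi\|^w\big).$$ Then $\mathbf Y_n=\mathbf X_n/\sqrt{t_n}$ converges in law to the standard Gaussian law $\mathcal N_{\mathbb R^d}(0,I_d)$. Moreover, for every $\delta\in(0,\frac12+\gamma)$, every $\mathbf y\in\mathbb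 R^d$ and every Jordan measurable set $B\subset\mathbb R^d$ (that is, a bounded measurable set whose boundary $\partial B$ has zero Lebesgue measure) with $m(B)>0$, $$\lim_{n\to\infty}(t_n)^{d\delta}\;\mathbb P\big[\mathbf Y_n-\mathbf y\in (t_n)^{-\delta}B\big]=\frac{e^{-\frac{\|\mathbf y\|^2}{2}}}{(2\pi)^{d/2}}\,m(B),$$ where $m(B)$ is the $d$-dimensional Lebesgue measure of $B$. -/

import Mathlib

open MeasureTheory ProbabilityTheory Filter Topology
open scoped Pointwise

namespace ModGaussian

/-- The residue `θ(ξ) = 𝔼[exp(i⟨ξ, X⟩)] · exp(t ‖ξ‖² / 2)` of a random vector `X` in `ℝ^d`,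
with parameter `t`. -/
noncomputable def residue {d : ℕ} {Ω : Type*} [MeasurableSpace Ω] (P : Measure Ω)
    (X : Ω → EuclideanSpace ℝ (Fin d)) (t : ℝ) (ξ : EuclideanSpace ℝ (Fin d)) : ℂ :=
  (∫ ω, Complex.exp (Complex.I * ((inner ℝ ξ (X ω) : ℝ) : ℂ)) ∂P) *
    ((Real.exp (t * ‖ξ‖ ^ 2 / 2) : ℝ) : ℂ)

/-- The cube `[-r, r]^d` in `ℝ^d`. -/
def cube (d : ℕ) (r : ℝ) : Set (EuclideanSpace ℝ (Fin d)) :=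
  {ξ | ∀ i, ξ i ∈ Set.Icc (-r) r}

/-- A Jordan measurable subset of `ℝ^d`: a bounded measurable set whose boundary has zero Lebesgue
measure. -/
structure IsJordanMeasurable {d : ℕ} (B : Set (EuclideanSpace ℝ (Fin d))) : Prop where
  isBounded : Bornology.IsBounded B
  measurableSet : MeasurableSet B
  volume_frontier : volume (frontier B) = 0

end ModGaussian

open MeasureTheory ProbabilityTheory Filter Topology
open scoped Pointwise

/-!
Write `Y n = X n / √(t n)`. The characteristic function of `Y n` at `ξ` is the residue at
`ξ / √(t n)` times `exp (-‖ξ‖² / 2)`. After shrinking `K`, the condition `γ ≤ 1 / (w - 2)` makes the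
factor `exp (K₂ ‖·‖ ^ w)` smaller than `exp (‖ξ‖² / 4)`, so on the zone `‖ξ‖ ≤ K' t n ^ (1 / 2 + γ)`
the characteristic function differs from `exp (-‖ξ‖² / 2)` by at most
`|K₁| (‖ξ‖ / √(t n)) ^ v exp (-‖ξ‖² / 4)` (`exists_norm_charFun_sub_le`). The zone exhausts the space
because `γ > -1 / 2`, and convergence in law follows from Lévy's theorem.

For the local statement, put `s = t n ^ δ` and test the law of `Z n = s • (Y n - y)`, multiplied by
`s ^ d`, against `exp (-‖x‖² / 2) exp (i ⟨x, η⟩)`. By Parseval's formula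
(`integral_gaussian_mul_cexp_rescaled_eq`) the result is, up to a constant, the integral of
`exp (-‖ξ / s - η‖² / 2) exp (-i ⟨ξ, y⟩)` against the characteristic function of `Y n`. Inside the
zone the estimate above gives an integrable bound; outside, the Gaussian weight of width
`s ≪ t n ^ (1 / 2 + γ)` does. Dominated convergence yields the limit
`exp (-‖y‖² / 2) exp (-‖η‖² / 2)` (`tendsto_integral_gaussian_mul_cexp_mul_charFun`).

The Gaussian weight turns the rescaled laws, whose masses tend to infinity, into finite measures.
Once they are normalised, Lévy's theorem applies to them, and gives convergence of the original
rescaled laws against every compactly supported continuous function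
(`tendsto_integral_of_tendsto_gaussian_mul_char`). Jordan measurable sets are reached by squeezing
their indicators between such functions (`tendsto_measureReal_of_tendsto_integral`).
-/

namespace ModGaussian

/-! ### Gaussian integrals and vague convergence -/

section GaussianWeight

variable {E : Type*} [NormedAddCommGroup E] [InnerProductSpace ℝ E] [FiniteDimensional ℝ E]
  [MeasurableSpace E] [BorelSpace E]

lemma integral_gaussian_mul_cexp (x : E) :
    ∫ ζ : E, (Real.exp (-‖ζ‖ ^ 2 / 2) : ℂ) * Complex.exp ((inner ℝ ζ x : ℝ) * Complex.I) =
      ((2 * Real.pi) ^ ((Module.finrank ℝ E : ℝ) / 2) * Real.exp (-‖x‖ ^ 2 / 2) : ℝ) := by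
  have h := GaussianFourier.integral_cexp_neg_mul_sq_norm_add (V := E) (b := (1 / 2 : ℂ))
    (by norm_num) Complex.I x
  have h2 : ((2 * Real.pi : ℝ) : ℂ) = Real.pi / (1 / 2 : ℂ) := by push_cast; ring
  rw [Complex.ofReal_mul, Complex.ofReal_cpow (by positivity), h2]
  push_cast
  convert h using 1
  · congr 1 with ζ
    rw [← Complex.exp_add, real_inner_comm]
    congr 1
    ring
  · rw [Complex.I_sq]
    congr 2
    ring

lemma integrable_exp_neg_sq_norm_div_two :
    Integrable (fun ζ : E ↦ Real.exp (-‖ζ‖ ^ 2 / 2)) := by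
  have h := (GaussianFourier.integrable_cexp_neg_mul_sq_norm_add (V := E) (b := (1 / 2 : ℂ))
    (by norm_num) 0 0).norm
  refine h.congr (ae_of_all _ fun ζ ↦ ?_)
  simp only [Complex.norm_exp]
  congr 1
  simp [← Complex.ofReal_pow]
  ring

lemma integral_exp_neg_sq_norm_div_two :
    ∫ ζ : E, Real.exp (-‖ζ‖ ^ 2 / 2) = (2 * Real.pi) ^ ((Module.finrank ℝ E : ℝ) / 2) := by
  have h := integral_gaussian_mul_cexp (0 : E)
  simp only [inner_zero_right, Complex.ofReal_zero, zero_mul, Complex.exp_zero, mul_one, norm_zero,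
    ne_eq, OfNat.ofNat_ne_zero, not_false_eq_true, zero_pow, neg_zero, zero_div, Real.exp_zero,
    integral_complex_ofReal] at h
  exact_mod_cast h

lemma integrable_exp_neg_sq_norm_div_two_of_isFiniteMeasure (Q : Measure E) [IsFiniteMeasure Q] :
    Integrable (fun x : E ↦ Real.exp (-‖x‖ ^ 2 / 2)) Q := by
  refine Integrable.of_bound (C := 1) (by fun_prop) (ae_of_all _ fun x ↦ ?_)
  rw [Real.norm_of_nonneg (Real.exp_pos _).le, Real.exp_le_one_iff]
  linarith [sq_nonneg ‖x‖]

omit [FiniteDimensional ℝ E] [BorelSpace E] in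
lemma charFun_tilted_gaussian (Q : Measure E) (η : E) :
    charFun (Q.tilted fun x ↦ -‖x‖ ^ 2 / 2) η =
      (∫ x, (Real.exp (-‖x‖ ^ 2 / 2) : ℂ) * Complex.exp ((inner ℝ x η : ℝ) * Complex.I) ∂Q) /
        ((∫ x, Real.exp (-‖x‖ ^ 2 / 2) ∂Q : ℝ) : ℂ) := by
  rw [charFun_apply, integral_tilted, ← integral_div]
  congr 1 with x
  rw [Complex.real_smul]
  push_cast
  ring

/-- Vague convergence from Gaussian-weighted characteristic functions. The weight `exp (-‖x‖² / 2)`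
turns the measures `M n • Q n`, whose total mass may be unbounded, into multiples of the
probability measures `(Q n).tilted`, to which Lévy's convergence theorem applies; as the weight is
bounded below on compact sets, it can be divided out against a compactly supported `f`. -/
lemma tendsto_integral_of_tendsto_gaussian_mul_char {Q : ℕ → Measure E}
    [∀ n, IsProbabilityMeasure (Q n)] {M : ℕ → ℝ} (hM : ∀ n, 0 < M n) {m : ℝ} (hm : 0 < m)
    (h : ∀ η : E, Tendsto (fun n ↦ (M n : ℂ) * ∫ x, (Real.exp (-‖x‖ ^ 2 / 2) : ℂ) *
      Complex.exp ((inner ℝ x η : ℝ) * Complex.I) ∂Q n) atTop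
      (𝓝 (m * (Real.exp (-‖η‖ ^ 2 / 2) : ℝ))))
    {f : E → ℝ} (hf : Continuous f) (hfc : HasCompactSupport f) :
    Tendsto (fun n ↦ M n * ∫ x, f x ∂Q n) atTop
      (𝓝 (m / (2 * Real.pi) ^ ((Module.finrank ℝ E : ℝ) / 2) * ∫ x, f x)) := by
  set G : E → ℝ := fun x ↦ -‖x‖ ^ 2 / 2 with hG
  have hint n : Integrable (fun x ↦ Real.exp (G x)) (Q n) :=
    integrable_exp_neg_sq_norm_div_two_of_isFiniteMeasure _
  have hprob n : IsProbabilityMeasure ((Q n).tilted G) := isProbabilityMeasure_tilted (hint n)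
  have hprob' : IsProbabilityMeasure ((volume : Measure E).tilted G) :=
    isProbabilityMeasure_tilted integrable_exp_neg_sq_norm_div_two
  have hmassC := h 0
  simp only [inner_zero_right, Complex.ofReal_zero, zero_mul, Complex.exp_zero, mul_one, norm_zero,
    ne_eq, OfNat.ofNat_ne_zero, not_false_eq_true, zero_pow, neg_zero, zero_div, Real.exp_zero,
    integral_complex_ofReal, Complex.ofReal_one] at hmassC
  have hmass : Tendsto (fun n ↦ M n * ∫ x, Real.exp (G x) ∂Q n) atTop (𝓝 m) := by
    have := (Complex.continuous_re.tendsto _).comp hmassC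
    simpa [Function.comp_def, ← Complex.ofReal_mul] using this
  have hpi : (0 : ℝ) < (2 * Real.pi) ^ ((Module.finrank ℝ E : ℝ) / 2) := by positivity
  -- Lévy's theorem for the tilted measures
  have hlevy : Tendsto (β := ProbabilityMeasure E) (fun n ↦ ⟨(Q n).tilted G, hprob n⟩) atTop
      (𝓝 ⟨(volume : Measure E).tilted G, hprob'⟩) := by
    refine ProbabilityMeasure.tendsto_of_tendsto_charFun fun η ↦ ?_
    simp only [ProbabilityMeasure.coe_mk, hG, charFun_tilted_gaussian, integral_gaussian_mul_cexp,
      integral_exp_neg_sq_norm_div_two]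
    have hlim := (h η).div hmassC (by exact_mod_cast hm.ne')
    rw [mul_div_cancel_left₀ _ (by exact_mod_cast hm.ne')] at hlim
    rw [Complex.ofReal_mul, mul_div_cancel_left₀ _ (by exact_mod_cast hpi.ne')]
    refine hlim.congr fun n ↦ ?_
    exact mul_div_mul_left _ _ (by exact_mod_cast (hM n).ne')
  have hlevy' := ProbabilityMeasure.tendsto_iff_forall_integral_tendsto.1 hlevy
  -- dividing out the weight keeps `f` bounded, by compactness of its support
  have hgc : Continuous fun x ↦ f x * Real.exp (‖x‖ ^ 2 / 2) := by fun_prop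
  obtain ⟨C, hC⟩ := hgc.bounded_above_of_compact_support hfc.mul_right
  have hg := hlevy' (BoundedContinuousFunction.ofNormedAddCommGroup _ hgc C hC)
  simp only [BoundedContinuousFunction.coe_ofNormedAddCommGroup, ProbabilityMeasure.coe_mk] at hg
  have key (Q : Measure E) : ∫ x, f x * Real.exp (‖x‖ ^ 2 / 2) ∂Q.tilted G =
      (∫ x, f x ∂Q) / ∫ x, Real.exp (G x) ∂Q := by
    rw [integral_tilted, ← integral_div]
    congr 1 with x
    have : Real.exp (G x) * Real.exp (‖x‖ ^ 2 / 2) = 1 := by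
      rw [← Real.exp_add, ← Real.exp_zero]
      congr 1
      simp only [hG]
      ring
    rw [smul_eq_mul, div_mul_eq_mul_div]
    congr 1
    linear_combination f x * this
  simp only [key] at hg
  have hfin := hmass.mul hg
  rw [show (∫ x : E, Real.exp (G x)) = _ from integral_exp_neg_sq_norm_div_two] at hfin
  refine (hfin.congr fun n ↦ ?_).trans_eq (by congr 1; ring)
  have hne : ∫ x, Real.exp (G x) ∂Q n ≠ 0 := (integral_exp_pos (hint n)).ne'
  field_simp

end GaussianWeight

/-! ### From compactly supported test functions to sets with null boundary -/

section Sandwich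

variable {E : Type*} [NormedAddCommGroup E] [NormedSpace ℝ E] [FiniteDimensional ℝ E]
  [MeasurableSpace E] [BorelSpace E]

omit [MeasurableSpace E] [BorelSpace E] in
lemma hasCompactSupport_thickenedIndicator {B : Set E} (hB : Bornology.IsBounded B) {r : ℝ}
    (hr : 0 < r) : HasCompactSupport fun x ↦ (thickenedIndicator hr B x : ℝ) := by
  refine HasCompactSupport.intro (K := closure (Metric.thickening r B)) ?_ fun x hx ↦ ?_
  · exact hB.thickening.isCompact_closure
  · rw [thickenedIndicator_zero hr B fun h ↦ hx (subset_closure h), NNReal.coe_zero]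

omit [MeasurableSpace E] [BorelSpace E] in
lemma hasCompactSupport_one_sub_thickenedIndicator_compl {B : Set E} (hB : Bornology.IsBounded B)
    {r : ℝ} (hr : 0 < r) : HasCompactSupport fun x ↦ 1 - (thickenedIndicator hr Bᶜ x : ℝ) := by
  refine HasCompactSupport.intro (K := closure B) hB.isCompact_closure fun x hx ↦ ?_
  rw [thickenedIndicator_one hr Bᶜ (fun h ↦ hx (subset_closure h)), NNReal.coe_one, sub_self]

/-- A portmanteau statement for vague convergence: the indicator of `B` lies between the compactly
supported functions `1 - thickenedIndicator Bᶜ` and `thickenedIndicator B`, whose integrals tend to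
`μ (interior B)` and `μ (closure B)`. -/
lemma tendsto_measureReal_of_tendsto_integral {μ : Measure E} [IsFiniteMeasureOnCompacts μ]
    {Q : ℕ → Measure E} [∀ n, IsFiniteMeasure (Q n)] {M : ℕ → ℝ} (hM : ∀ n, 0 ≤ M n) {c : ℝ}
    (h : ∀ f : E → ℝ, Continuous f → HasCompactSupport f →
      Tendsto (fun n ↦ M n * ∫ x, f x ∂Q n) atTop (𝓝 (c * ∫ x, f x ∂μ)))
    {B : Set E} (hB : Bornology.IsBounded B) (hBm : MeasurableSet B) (hfr : μ (frontier B) = 0) :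
    Tendsto (fun n ↦ M n * (Q n).real B) atTop (𝓝 (c * μ.real B)) := by
  set r : ℕ → ℝ := fun k ↦ 1 / ((k : ℝ) + 1) with hr_def
  have hr k : 0 < r k := Nat.one_div_pos_of_nat
  have hr1 k : r k ≤ 1 := by
    simp only [hr_def]
    rw [div_le_one (by positivity)]
    linarith [(Nat.cast_nonneg k : (0 : ℝ) ≤ k)]
  have hr0 : Tendsto r atTop (𝓝 0) := tendsto_one_div_add_atTop_nhds_zero_nat
  set u : ℕ → E → ℝ := fun k x ↦ (thickenedIndicator (hr k) B x : ℝ) with hu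
  set l : ℕ → E → ℝ := fun k x ↦ 1 - (thickenedIndicator (hr k) Bᶜ x : ℝ) with hl
  have huc k : Continuous (u k) := by fun_prop
  have hlc k : Continuous (l k) := by fun_prop
  have hus k : HasCompactSupport (u k) := hasCompactSupport_thickenedIndicator hB (hr k)
  have hls k : HasCompactSupport (l k) :=
    hasCompactSupport_one_sub_thickenedIndicator_compl hB (hr k)
  have hu0 k x : 0 ≤ u k x := NNReal.coe_nonneg _
  have hu1 k x : u k x ≤ 1 := thickenedIndicator_le_one (hr k) B x
  have hl0 k x : 0 ≤ l k x := sub_nonneg.2 (thickenedIndicator_le_one (hr k) Bᶜ x)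
  have hl1 k x : l k x ≤ 1 := sub_le_self _ (NNReal.coe_nonneg _)
  have hle k x : l k x ≤ B.indicator 1 x := by
    by_cases hx : x ∈ B
    · simpa only [Set.indicator_of_mem hx, Pi.one_apply] using hl1 k x
    · have : l k x = 0 := by
        simp only [hl]
        rw [thickenedIndicator_one (hr k) Bᶜ hx, NNReal.coe_one, sub_self]
      rw [Set.indicator_of_notMem hx, this]
  have hge k x : B.indicator 1 x ≤ u k x := by
    by_cases hx : x ∈ B
    · have : u k x = 1 := by
        simp only [hu]
        rw [thickenedIndicator_one (hr k) B hx, NNReal.coe_one]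
      rw [Set.indicator_of_mem hx, this, Pi.one_apply]
    · simpa only [Set.indicator_of_notMem hx] using hu0 k x
  have hQ n : (Q n).real B = ∫ x, B.indicator 1 x ∂Q n := (integral_indicator_one hBm).symm
  have hfinB : μ B ≠ ⊤ :=
    ((measure_mono subset_closure).trans_lt hB.isCompact_closure.measure_lt_top).ne
  have hintB n : Integrable (B.indicator (1 : E → ℝ)) (Q n) :=
    (integrable_const (1 : ℝ)).indicator hBm
  have hclos : (closure B).indicator (1 : E → ℝ) =ᵐ[μ] B.indicator 1 :=
    indicator_ae_eq_of_ae_eq_set (closure_ae_eq_of_null_frontier hfr)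
  have hint : (interior B).indicator (1 : E → ℝ) =ᵐ[μ] B.indicator 1 :=
    indicator_ae_eq_of_ae_eq_set (interior_ae_eq_of_null_frontier hfr)
  have hulim : Tendsto (fun k ↦ ∫ x, u k x ∂μ) atTop (𝓝 (μ.real B)) := by
    rw [← integral_indicator_one hBm, ← integral_congr_ae hclos]
    have hbound : Integrable ((closure (Metric.thickening 1 B)).indicator (1 : E → ℝ)) μ :=
      (integrable_indicator_iff isClosed_closure.measurableSet).2
        (integrableOn_const hB.thickening.isCompact_closure.measure_lt_top.ne)
    refine tendsto_integral_of_dominated_convergence _ (fun k ↦ (huc k).aestronglyMeasurable)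
      hbound (fun k ↦ ae_of_all _ fun x ↦ ?_) (ae_of_all _ fun x ↦ ?_)
    · rw [Real.norm_of_nonneg (hu0 k x)]
      by_cases hx : x ∈ closure (Metric.thickening 1 B)
      · simpa only [Set.indicator_of_mem hx, Pi.one_apply] using hu1 k x
      · have hx' : x ∉ Metric.thickening (r k) B := fun h' ↦
          hx (subset_closure (Metric.thickening_mono (hr1 k) B h'))
        have : u k x = 0 := by
          simp only [hu]
          rw [thickenedIndicator_zero (hr k) B hx', NNReal.coe_zero]
        rw [Set.indicator_of_notMem hx, this]
    · have := tendsto_pi_nhds.1 (thickenedIndicator_tendsto_indicator_closure hr hr0 B) x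
      refine ((NNReal.continuous_coe.tendsto _).comp this).trans_eq ?_
      congr 1
      by_cases hx : x ∈ closure B
      · rw [Set.indicator_of_mem hx, Set.indicator_of_mem hx, NNReal.coe_one, Pi.one_apply]
      · rw [Set.indicator_of_notMem hx, Set.indicator_of_notMem hx, NNReal.coe_zero]
  have hllim : Tendsto (fun k ↦ ∫ x, l k x ∂μ) atTop (𝓝 (μ.real B)) := by
    rw [← integral_indicator_one hBm, ← integral_congr_ae hint]
    have hbound : Integrable (B.indicator (1 : E → ℝ)) μ :=
      (integrable_indicator_iff hBm).2 (integrableOn_const hfinB)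
    refine tendsto_integral_of_dominated_convergence _ (fun k ↦ (hlc k).aestronglyMeasurable)
      hbound (fun k ↦ ae_of_all _ fun x ↦ ?_) (ae_of_all _ fun x ↦ ?_)
    · rw [Real.norm_of_nonneg (hl0 k x)]
      exact hle k x
    · have := tendsto_pi_nhds.1 (thickenedIndicator_tendsto_indicator_closure hr hr0 Bᶜ) x
      refine (((NNReal.continuous_coe.tendsto _).comp this).const_sub 1).trans_eq ?_
      congr 1
      rw [closure_compl]
      by_cases hx : x ∈ interior B
      · rw [Set.indicator_of_mem hx, Set.indicator_of_notMem (Set.notMem_compl_iff.2 hx), NNReal.coe_zero,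
          sub_zero, Pi.one_apply]
      · rw [Set.indicator_of_notMem hx, Set.indicator_of_mem hx, NNReal.coe_one, sub_self]
  refine tendsto_order.2 ⟨fun a ha ↦ ?_, fun a ha ↦ ?_⟩
  · obtain ⟨k, hk⟩ := ((hllim.const_mul c).eventually (lt_mem_nhds ha)).exists
    filter_upwards [(h (l k) (hlc k) (hls k)).eventually (lt_mem_nhds hk)] with n hn
    refine hn.trans_le (mul_le_mul_of_nonneg_left ?_ (hM n))
    rw [hQ]
    exact integral_mono ((hlc k).integrable_of_hasCompactSupport (hls k)) (hintB n) (hle k)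
  · obtain ⟨k, hk⟩ := ((hulim.const_mul c).eventually (gt_mem_nhds ha)).exists
    filter_upwards [(h (u k) (huc k) (hus k)).eventually (gt_mem_nhds hk)] with n hn
    refine (mul_le_mul_of_nonneg_left ?_ (hM n)).trans_lt hn
    rw [hQ]
    exact integral_mono (hintB n) ((huc k).integrable_of_hasCompactSupport (hus k)) (hge k)

end Sandwich

/-! ### Parseval's formula for a Gaussian test function -/

section Fourier

variable {E : Type*} [NormedAddCommGroup E] [InnerProductSpace ℝ E] [FiniteDimensional ℝ E]
  [MeasurableSpace E] [BorelSpace E]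

lemma integral_rescaled_gaussian_mul_cexp {s : ℝ} (hs : 0 < s) (η z : E) :
    ∫ ξ : E, (Real.exp (-‖s⁻¹ • ξ - η‖ ^ 2 / 2) : ℂ) *
        Complex.exp ((inner ℝ ξ z : ℝ) * Complex.I) =
      (s ^ Module.finrank ℝ E * (2 * Real.pi) ^ ((Module.finrank ℝ E : ℝ) / 2) : ℝ) *
        ((Real.exp (-‖s • z‖ ^ 2 / 2) : ℂ) *
          Complex.exp ((inner ℝ (s • z) η : ℝ) * Complex.I)) := by
  have h1 := Measure.integral_comp_smul (volume : Measure E)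
    (fun u ↦ (Real.exp (-‖u - η‖ ^ 2 / 2) : ℂ) *
      Complex.exp ((inner ℝ (s • u) z : ℝ) * Complex.I)) s⁻¹
  simp only [smul_inv_smul₀ hs.ne'] at h1
  rw [h1, ← integral_add_right_eq_self _ η, inv_pow, inv_inv, abs_of_pos (pow_pos hs _)]
  have h2 (u : E) : (Real.exp (-‖u + η - η‖ ^ 2 / 2) : ℂ) *
      Complex.exp ((inner ℝ (s • (u + η)) z : ℝ) * Complex.I) =
      ((Real.exp (-‖u‖ ^ 2 / 2) : ℂ) * Complex.exp ((inner ℝ u (s • z) : ℝ) * Complex.I)) *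
        Complex.exp ((inner ℝ (s • z) η : ℝ) * Complex.I) := by
    rw [mul_assoc, ← Complex.exp_add, add_sub_cancel_right, ← add_mul, ← Complex.ofReal_add,
      real_inner_comm η (s • z)]
    simp only [inner_add_left, real_inner_smul_left, real_inner_smul_right, mul_add]
  simp only [h2]
  rw [integral_mul_const, integral_gaussian_mul_cexp, Complex.real_smul]
  push_cast
  ring

/-- The Gaussian-weighted characteristic function of `s • (Y - y)`, where `Y` has law `Q`, as an
integral of the characteristic function of `Y` (Parseval's formula). -/
lemma integral_gaussian_mul_cexp_rescaled_eq {Q : Measure E} [IsProbabilityMeasure Q] {s : ℝ}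
    (hs : 0 < s) (η y : E) :
    ((s ^ Module.finrank ℝ E : ℝ) : ℂ) * ∫ x, (Real.exp (-‖s • (x - y)‖ ^ 2 / 2) : ℂ) *
        Complex.exp ((inner ℝ (s • (x - y)) η : ℝ) * Complex.I) ∂Q =
      (((2 * Real.pi) ^ ((Module.finrank ℝ E : ℝ) / 2) : ℝ) : ℂ)⁻¹ *
        ∫ ξ, (Real.exp (-‖s⁻¹ • ξ - η‖ ^ 2 / 2) : ℂ) *
          Complex.exp ((inner ℝ ξ (-y) : ℝ) * Complex.I) * charFun Q ξ := by
  have hpi : (((2 * Real.pi) ^ ((Module.finrank ℝ E : ℝ) / 2) : ℝ) : ℂ) ≠ 0 := by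
    exact_mod_cast (by positivity : (0 : ℝ) < (2 * Real.pi) ^ ((Module.finrank ℝ E : ℝ) / 2)).ne'
  rw [eq_inv_mul_iff_mul_eq₀ hpi, ← mul_assoc, ← integral_const_mul]
  have h1 (x : E) := integral_rescaled_gaussian_mul_cexp hs η (x - y)
  simp only [mul_comm (s ^ Module.finrank ℝ E)] at h1
  rw [← Complex.ofReal_mul]
  simp only [← h1]
  have hg : Integrable fun ξ : E ↦ Real.exp (-‖s⁻¹ • ξ - η‖ ^ 2 / 2) :=
    ((integrable_exp_neg_sq_norm_div_two (E := E)).comp_sub_right η).comp_smul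
      (inv_ne_zero hs.ne')
  rw [integral_integral_swap]
  · congr 1 with ξ
    rw [charFun_apply, ← integral_const_mul]
    congr 1 with x
    rw [mul_assoc, ← Complex.exp_add, ← add_mul, ← Complex.ofReal_add, real_inner_comm ξ x,
      ← inner_add_right, neg_add_eq_sub]
  · refine ((integrable_const (1 : ℝ)).mul_prod hg : Integrable _ (Q.prod volume)).mono'
      (Continuous.aestronglyMeasurable ?_) (ae_of_all _ fun p ↦ ?_)
    · simp only [Function.uncurry_def]
      fun_prop
    · simp only [Function.uncurry_def, norm_mul, Complex.norm_exp_ofReal_mul_I, mul_one, one_mul,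
        Complex.norm_real]
      exact (Real.norm_of_nonneg (Real.exp_pos _).le).le

end Fourier

/-! ### Estimates in one real variable -/

section RealBounds

lemma exists_exp_neg_mul_rpow_le {p a β : ℝ} (hp : 0 ≤ p) (ha : 0 < a) (hβ : 0 < β) :
    ∃ C, ∀ r : ℝ, 0 ≤ r → Real.exp (-(a * r ^ β)) ≤ C * (1 + r) ^ (-p) := by
  -- `exp x ≥ x ^ k / k!` for an integer `k` with `k * β ≥ p`
  obtain ⟨k, hk⟩ := exists_nat_ge (p / β)
  rw [div_le_iff₀ hβ] at hk
  have hfac : (0 : ℝ) < k.factorial := by exact_mod_cast k.factorial_pos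
  refine ⟨2 ^ p * (1 + k.factorial / a ^ k), fun r hr ↦ ?_⟩
  have h1r : (0 : ℝ) < 1 + r := by positivity
  rw [Real.rpow_neg h1r.le, ← div_eq_mul_inv, le_div_iff₀ (by positivity)]
  rcases le_total r 1 with h | h
  · calc Real.exp (-(a * r ^ β)) * (1 + r) ^ p ≤ 1 * 2 ^ p := by
          gcongr
          · exact Real.exp_le_one_iff.2 (neg_nonpos.2 (by positivity))
          · linarith
      _ ≤ 2 ^ p * (1 + k.factorial / a ^ k) := by
          rw [one_mul]
          exact le_mul_of_one_le_right (by positivity) (le_add_of_nonneg_right (by positivity))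
  · have hr0 : 0 < r := by linarith
    have h2 : r ^ p ≤ (r ^ β) ^ k := by
      rw [← Real.rpow_natCast, ← Real.rpow_mul hr]
      exact Real.rpow_le_rpow_of_exponent_le h (by linarith)
    have h3 := Real.pow_div_factorial_le_exp (a * r ^ β) (by positivity) k
    have h4 : Real.exp (-(a * r ^ β)) * r ^ p ≤ k.factorial / a ^ k := by
      rw [Real.exp_neg, inv_mul_le_iff₀ (Real.exp_pos _)]
      calc r ^ p ≤ (r ^ β) ^ k := h2
        _ = (a * r ^ β) ^ k / k.factorial * (k.factorial / a ^ k) := by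
          rw [mul_pow]; field_simp
        _ ≤ _ := by gcongr
    calc Real.exp (-(a * r ^ β)) * (1 + r) ^ p ≤ Real.exp (-(a * r ^ β)) * (2 * r) ^ p := by
          gcongr; linarith
      _ = 2 ^ p * (Real.exp (-(a * r ^ β)) * r ^ p) := by
          rw [Real.mul_rpow (by norm_num) hr]; ring
      _ ≤ 2 ^ p * (1 + k.factorial / a ^ k) := by gcongr; linarith

lemma exists_rpow_mul_exp_neg_mul_sq_le {p a v : ℝ} (hp : 0 ≤ p) (ha : 0 < a) (hv : 0 ≤ v) :
    ∃ C, ∀ r : ℝ, 0 ≤ r → r ^ v * Real.exp (-(a * r ^ 2)) ≤ C * (1 + r) ^ (-p) := by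
  obtain ⟨C, hC⟩ := exists_exp_neg_mul_rpow_le (p := p + v) (by positivity) ha zero_lt_two
  refine ⟨C, fun r hr ↦ ?_⟩
  have h1r : (0 : ℝ) < 1 + r := by positivity
  have h := hC r hr
  rw [Real.rpow_two] at h
  calc r ^ v * Real.exp (-(a * r ^ 2)) ≤ (1 + r) ^ v * (C * (1 + r) ^ (-(p + v))) := by
        gcongr; linarith
    _ = C * (1 + r) ^ (-p) := by
        rw [mul_left_comm, ← Real.rpow_add h1r]
        congr 2
        ring

/-- After shrinking the zone of control, the factor `exp (K₂ ‖ξ‖ ^ w)` is dominated by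
`exp (T ‖ξ‖² / 4)`. This is where the bound `γ ≤ 1 / (w - 2)` enters. -/
lemma exists_zone_mul_rpow_le {K K₂ w γ : ℝ} (hK : 0 < K) (hw : 2 ≤ w)
    (hγw : 2 < w → γ ≤ 1 / (w - 2)) :
    ∃ K', 0 < K' ∧ K' ≤ K ∧ ∀ᶠ T : ℝ in atTop, ∀ r, 0 ≤ r → r ≤ K' * T ^ γ →
      K₂ * r ^ w ≤ T * r ^ 2 / 4 := by
  have hA : 0 < 4 * (|K₂| + 1) := by positivity
  suffices h : ∃ K', 0 < K' ∧ K' ≤ K ∧ ∀ᶠ T : ℝ in atTop,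
      |K₂| * (K' * T ^ γ) ^ (w - 2) ≤ T / 4 by
    obtain ⟨K', hK', hK'K, h⟩ := h
    refine ⟨K', hK', hK'K, ?_⟩
    filter_upwards [h] with T hT r hr hrT
    have hsplit : r ^ w = r ^ (w - 2) * r ^ 2 := by
      rw [← Real.rpow_two, ← Real.rpow_add_of_nonneg hr (by linarith) (by norm_num)]
      congr 1
      ring
    calc K₂ * r ^ w ≤ |K₂| * ((K' * T ^ γ) ^ (w - 2) * r ^ 2) := by
          rw [hsplit]
          gcongr
          exact le_abs_self _
      _ = |K₂| * (K' * T ^ γ) ^ (w - 2) * r ^ 2 := by ring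
      _ ≤ T / 4 * r ^ 2 := by gcongr
      _ = T * r ^ 2 / 4 := by ring
  rcases hw.eq_or_lt with rfl | hw
  · refine ⟨K, hK, le_rfl, ?_⟩
    filter_upwards [eventually_ge_atTop (4 * |K₂|)] with T hT
    rw [sub_self, Real.rpow_zero]
    linarith
  · have hw' : 0 < w - 2 := by linarith
    -- the second term makes `|K₂| * K' ^ (w - 2) ≤ 1 / 4`
    refine ⟨min K ((4 * (|K₂| + 1))⁻¹ ^ (w - 2)⁻¹), lt_min hK (by positivity), min_le_left _ _, ?_⟩
    filter_upwards [eventually_ge_atTop 1] with T hT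
    have hT0 : 0 < T := by linarith
    have h1 : (min K ((4 * (|K₂| + 1))⁻¹ ^ (w - 2)⁻¹)) ^ (w - 2) ≤ (4 * (|K₂| + 1))⁻¹ := by
      calc _ ≤ ((4 * (|K₂| + 1))⁻¹ ^ (w - 2)⁻¹) ^ (w - 2) := by
            gcongr
            exact min_le_right _ _
        _ = _ := by
            rw [← Real.rpow_mul (by positivity), inv_mul_cancel₀ hw'.ne', Real.rpow_one]
    have h2 : (T ^ γ) ^ (w - 2) ≤ T := by
      rw [← Real.rpow_mul hT0.le]
      refine (Real.rpow_le_rpow_of_exponent_le hT ?_).trans_eq (Real.rpow_one T)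
      exact (le_div_iff₀ hw').1 (hγw hw)
    rw [Real.mul_rpow (by positivity) (by positivity)]
    calc |K₂| * (_ * (T ^ γ) ^ (w - 2)) ≤ (|K₂| + 1) * ((4 * (|K₂| + 1))⁻¹ * T) := by
          gcongr
          linarith
      _ = T / 4 := by field_simp

/-- Outside the zone, `T` is bounded by a power of `r`, so that the ratio `r / T ^ δ` is bounded
below by a power of `r` alone, with positive exponent as soon as `δ < ρ`. -/
lemma mul_rpow_sub_le_sq_div {K' T ρ δ r : ℝ} (hK' : 0 < K') (hT : 0 < T) (hρ : 0 < ρ)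
    (hδ : 0 < δ) (hr : K' * T ^ ρ ≤ r) :
    K' ^ (2 * δ / ρ) * r ^ (2 - 2 * δ / ρ) ≤ r ^ 2 / (T ^ δ) ^ 2 := by
  have hr0 : 0 < r := lt_of_lt_of_le (by positivity) hr
  rw [le_div_iff₀ (by positivity)]
  have h1 : (T ^ δ) ^ 2 = (T ^ ρ) ^ (2 * δ / ρ) := by
    rw [← Real.rpow_mul hT.le, ← Real.rpow_two, ← Real.rpow_mul hT.le]
    congr 1
    field_simp
  calc K' ^ (2 * δ / ρ) * r ^ (2 - 2 * δ / ρ) * (T ^ δ) ^ 2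
      = (K' * T ^ ρ) ^ (2 * δ / ρ) * r ^ (2 - 2 * δ / ρ) := by
        rw [h1, Real.mul_rpow hK'.le (by positivity)]; ring
    _ ≤ r ^ (2 * δ / ρ) * r ^ (2 - 2 * δ / ρ) := by gcongr
    _ = r ^ 2 := by
        rw [← Real.rpow_add hr0, add_sub_cancel, Real.rpow_two]

end RealBounds

/-! ### The local limit theorem in terms of characteristic functions -/

section Limit

variable {E : Type*} [NormedAddCommGroup E] [InnerProductSpace ℝ E] [FiniteDimensional ℝ E]
  [MeasurableSpace E] [BorelSpace E]

omit [FiniteDimensional ℝ E] [BorelSpace E] in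
lemma tendsto_charFun_of_norm_sub_le {Q : ℕ → Measure E} {t : ℕ → ℝ} (ht : Tendsto t atTop atTop)
    {C v ρ K : ℝ} (hv : 0 < v) (hρ : 0 < ρ) (hK : 0 < K)
    (h : ∀ᶠ n in atTop, ∀ ξ, ‖ξ‖ ≤ K * t n ^ ρ →
      ‖charFun (Q n) ξ - (Real.exp (-‖ξ‖ ^ 2 / 2) : ℝ)‖ ≤
        C * (‖ξ‖ / √(t n)) ^ v * Real.exp (-‖ξ‖ ^ 2 / 4)) (ξ : E) :
    Tendsto (fun n ↦ charFun (Q n) ξ) atTop (𝓝 (Real.exp (-‖ξ‖ ^ 2 / 2) : ℝ)) := by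
  rw [tendsto_iff_norm_sub_tendsto_zero]
  have hzone : ∀ᶠ n in atTop, ‖ξ‖ ≤ K * t n ^ ρ :=
    (((tendsto_rpow_atTop hρ).comp ht).const_mul_atTop hK).eventually_ge_atTop _
  have hlim : Tendsto (fun n ↦ C * (‖ξ‖ / √(t n)) ^ v * Real.exp (-‖ξ‖ ^ 2 / 4)) atTop (𝓝 0) := by
    have h1 : Tendsto (fun n ↦ ‖ξ‖ / √(t n)) atTop (𝓝 0) :=
      (Real.tendsto_sqrt_atTop.comp ht).const_div_atTop _
    have h2 := h1.rpow_const (p := v) (Or.inr hv.le)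
    rw [Real.zero_rpow hv.ne'] at h2
    simpa using (h2.const_mul C).mul_const (Real.exp (-‖ξ‖ ^ 2 / 4))
  refine squeeze_zero' (Eventually.of_forall fun _ ↦ norm_nonneg _) ?_ hlim
  filter_upwards [h, hzone] with n h1 h2 using h1 ξ h2

omit [FiniteDimensional ℝ E] [MeasurableSpace E] [BorelSpace E] in
lemma exp_neg_sq_norm_rescaled_sub_le {K T ρ δ : ℝ} (hK : 0 < K) (hT : 0 < T) (hρ : 0 < ρ)
    (hδ : 0 < δ) (η : E) {ξ : E} (hξ : K * T ^ ρ ≤ ‖ξ‖) :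
    Real.exp (-‖(T ^ δ)⁻¹ • ξ - η‖ ^ 2 / 2) ≤ Real.exp (‖η‖ ^ 2 / 2) *
      Real.exp (-(K ^ (2 * δ / ρ) / 4 * ‖ξ‖ ^ (2 - 2 * δ / ρ))) := by
  rw [← Real.exp_add, Real.exp_le_exp]
  have h1 := mul_rpow_sub_le_sq_div hK hT hρ hδ hξ
  have h2 : ‖(T ^ δ)⁻¹ • ξ‖ ^ 2 = ‖ξ‖ ^ 2 / (T ^ δ) ^ 2 := by
    rw [norm_smul, Real.norm_of_nonneg (by positivity), mul_pow, inv_pow, div_eq_inv_mul]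
  have h3 : ‖(T ^ δ)⁻¹ • ξ‖ ≤ ‖(T ^ δ)⁻¹ • ξ - η‖ + ‖η‖ := by
    simpa using norm_add_le ((T ^ δ)⁻¹ • ξ - η) η
  have h4 : ‖(T ^ δ)⁻¹ • ξ‖ ^ 2 ≤ 2 * ‖(T ^ δ)⁻¹ • ξ - η‖ ^ 2 + 2 * ‖η‖ ^ 2 := by
    nlinarith [sq_nonneg (‖(T ^ δ)⁻¹ • ξ - η‖ - ‖η‖), norm_nonneg ((T ^ δ)⁻¹ • ξ)]
  linarith

/-- Inside the zone `‖ξ‖ ≤ K * t n ^ ρ` the characteristic functions are dominated by their Gaussian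
approximation; outside it, they are bounded by `1` and the Gaussian weight, whose width `t n ^ δ`
is much smaller than `t n ^ ρ`, is dominated by a stretched exponential that does not depend
on `n`. -/
lemma tendsto_integral_gaussian_mul_cexp_mul_charFun {Q : ℕ → Measure E}
    [∀ n, IsProbabilityMeasure (Q n)] {t : ℕ → ℝ} (ht : Tendsto t atTop atTop)
    {C v ρ K δ : ℝ} (hC : 0 ≤ C) (hv : 0 < v) (hK : 0 < K) (hδ : 0 < δ) (hδρ : δ < ρ)
    (h : ∀ᶠ n in atTop, ∀ ξ, ‖ξ‖ ≤ K * t n ^ ρ →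
      ‖charFun (Q n) ξ - (Real.exp (-‖ξ‖ ^ 2 / 2) : ℝ)‖ ≤
        C * (‖ξ‖ / √(t n)) ^ v * Real.exp (-‖ξ‖ ^ 2 / 4)) (η y : E) :
    Tendsto (fun n ↦ ∫ ξ, (Real.exp (-‖(t n ^ δ)⁻¹ • ξ - η‖ ^ 2 / 2) : ℂ) *
        Complex.exp ((inner ℝ ξ (-y) : ℝ) * Complex.I) * charFun (Q n) ξ) atTop
      (𝓝 (((2 * Real.pi) ^ ((Module.finrank ℝ E : ℝ) / 2) : ℝ) *
        ((Real.exp (-‖y‖ ^ 2 / 2) : ℝ) * (Real.exp (-‖η‖ ^ 2 / 2) : ℝ)))) := by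
  have hρ : 0 < ρ := hδ.trans hδρ
  have hval : ∫ ξ : E, (Real.exp (-‖η‖ ^ 2 / 2) : ℂ) *
      Complex.exp ((inner ℝ ξ (-y) : ℝ) * Complex.I) * (Real.exp (-‖ξ‖ ^ 2 / 2) : ℝ) =
      ((2 * Real.pi) ^ ((Module.finrank ℝ E : ℝ) / 2) : ℝ) *
        ((Real.exp (-‖y‖ ^ 2 / 2) : ℝ) * (Real.exp (-‖η‖ ^ 2 / 2) : ℝ)) := by
    rw [← mul_assoc, ← Complex.ofReal_mul, ← norm_neg y, ← integral_gaussian_mul_cexp,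
      ← integral_mul_const]
    congr 1 with ξ
    ring
  rw [← hval]
  -- every dominating function is compared with the integrable function `(1 + ‖ξ‖) ^ (-p)`
  set p : ℝ := Module.finrank ℝ E + 1 with hp_def
  have hp : 0 ≤ p := by positivity
  have hβ : 0 < 2 - 2 * δ / ρ := by
    rw [sub_pos, div_lt_iff₀ hρ]
    linarith
  obtain ⟨C₁, hC₁⟩ := exists_rpow_mul_exp_neg_mul_sq_le (a := 1 / 2) (v := 0) hp (by norm_num) le_rfl
  obtain ⟨C₂, hC₂⟩ := exists_rpow_mul_exp_neg_mul_sq_le (a := 1 / 4) hp (by norm_num) hv.le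
  obtain ⟨C₃, hC₃⟩ := exists_exp_neg_mul_rpow_le (a := K ^ (2 * δ / ρ) / 4) hp (by positivity) hβ
  set g₁ : E → ℝ := fun ξ ↦ C₁ * (1 + ‖ξ‖) ^ (-p) + C * (C₂ * (1 + ‖ξ‖) ^ (-p)) with hg₁
  set g₂ : E → ℝ := fun ξ ↦ Real.exp (‖η‖ ^ 2 / 2) * (C₃ * (1 + ‖ξ‖) ^ (-p)) with hg₂
  have hjap : Integrable fun ξ : E ↦ (1 + ‖ξ‖) ^ (-p) := integrable_one_add_norm (by linarith)
  have hbound : Integrable (g₁ + g₂) :=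
    ((hjap.const_mul _).add ((hjap.const_mul _).const_mul _)).add ((hjap.const_mul _).const_mul _)
  have hg₁0 ξ : 0 ≤ g₁ ξ := by
    refine add_nonneg ?_ (mul_nonneg hC ?_)
    · exact le_trans (by positivity) (hC₁ ‖ξ‖ (norm_nonneg _))
    · exact le_trans (by positivity) (hC₂ ‖ξ‖ (norm_nonneg _))
  have hg₂0 ξ : 0 ≤ g₂ ξ :=
    mul_nonneg (Real.exp_pos _).le (le_trans (by positivity) (hC₃ ‖ξ‖ (norm_nonneg _)))
  have hnorm n ξ : ‖(Real.exp (-‖(t n ^ δ)⁻¹ • ξ - η‖ ^ 2 / 2) : ℂ) *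
      Complex.exp ((inner ℝ ξ (-y) : ℝ) * Complex.I) * charFun (Q n) ξ‖ =
      Real.exp (-‖(t n ^ δ)⁻¹ • ξ - η‖ ^ 2 / 2) * ‖charFun (Q n) ξ‖ := by
    rw [norm_mul, norm_mul, Complex.norm_exp_ofReal_mul_I, mul_one, Complex.norm_real,
      Real.norm_of_nonneg (Real.exp_pos _).le]
  refine tendsto_integral_filter_of_dominated_convergence (g₁ + g₂) ?_ ?_ hbound ?_
  · refine Eventually.of_forall fun n ↦ Continuous.aestronglyMeasurable ?_
    have : Continuous (charFun (Q n)) := continuous_charFun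
    fun_prop
  · filter_upwards [h, ht.eventually_ge_atTop 1] with n hn hn1
    have ht0 : 0 < t n := by linarith
    refine ae_of_all _ fun ξ ↦ ?_
    rw [hnorm, Pi.add_apply]
    rcases le_total ‖ξ‖ (K * t n ^ ρ) with hξ | hξ
    · refine le_add_of_le_of_nonneg ?_ (hg₂0 ξ)
      have h1 : Real.exp (-‖(t n ^ δ)⁻¹ • ξ - η‖ ^ 2 / 2) ≤ 1 :=
        Real.exp_le_one_iff.2 (by linarith [sq_nonneg ‖(t n ^ δ)⁻¹ • ξ - η‖])
      have h2 : ‖charFun (Q n) ξ‖ ≤ Real.exp (-‖ξ‖ ^ 2 / 2) +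
          C * (‖ξ‖ / √(t n)) ^ v * Real.exp (-‖ξ‖ ^ 2 / 4) := by
        have := norm_le_norm_add_norm_sub' (charFun (Q n) ξ) (Real.exp (-‖ξ‖ ^ 2 / 2) : ℝ)
        rw [Complex.norm_real, Real.norm_of_nonneg (Real.exp_pos _).le] at this
        exact this.trans (add_le_add_right (hn ξ hξ) _)
      have h3 : ‖ξ‖ / √(t n) ≤ ‖ξ‖ :=
        div_le_self (norm_nonneg _) (Real.one_le_sqrt.2 hn1)
      have h4 := hC₁ ‖ξ‖ (norm_nonneg _)
      have h5 := hC₂ ‖ξ‖ (norm_nonneg _)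
      rw [Real.rpow_zero, one_mul, show -(1 / 2 * ‖ξ‖ ^ 2) = -‖ξ‖ ^ 2 / 2 by ring] at h4
      rw [show -(1 / 4 * ‖ξ‖ ^ 2) = -‖ξ‖ ^ 2 / 4 by ring] at h5
      calc _ ≤ 1 * ‖charFun (Q n) ξ‖ := by gcongr
        _ ≤ Real.exp (-‖ξ‖ ^ 2 / 2) + C * (‖ξ‖ / √(t n)) ^ v * Real.exp (-‖ξ‖ ^ 2 / 4) := by
          rwa [one_mul]
        _ ≤ Real.exp (-‖ξ‖ ^ 2 / 2) + C * (‖ξ‖ ^ v * Real.exp (-‖ξ‖ ^ 2 / 4)) := by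
          rw [← mul_assoc]
          gcongr
        _ ≤ g₁ ξ := by
          simp only [hg₁]
          gcongr
    · refine le_add_of_nonneg_of_le (hg₁0 ξ) ?_
      calc _ ≤ Real.exp (-‖(t n ^ δ)⁻¹ • ξ - η‖ ^ 2 / 2) * 1 := by
            gcongr
            exact norm_charFun_le_one ξ
        _ ≤ Real.exp (‖η‖ ^ 2 / 2) *
            Real.exp (-(K ^ (2 * δ / ρ) / 4 * ‖ξ‖ ^ (2 - 2 * δ / ρ))) := by
          rw [mul_one]
          exact exp_neg_sq_norm_rescaled_sub_le hK ht0 hρ hδ η hξ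
        _ ≤ g₂ ξ := mul_le_mul_of_nonneg_left (hC₃ ‖ξ‖ (norm_nonneg _)) (Real.exp_pos _).le
  · refine ae_of_all _ fun ξ ↦ ?_
    refine Tendsto.mul (Tendsto.mul_const _ ?_) (tendsto_charFun_of_norm_sub_le ht hv hρ hK h ξ)
    have h1 : Tendsto (fun n ↦ (t n ^ δ)⁻¹) atTop (𝓝 0) :=
      ((tendsto_rpow_atTop hδ).comp ht).inv_tendsto_atTop
    have h2 : Continuous fun a : ℝ ↦ (Real.exp (-‖a • ξ - η‖ ^ 2 / 2) : ℂ) := by fun_prop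
    have h3 := (h2.tendsto 0).comp h1
    simpa only [Function.comp_def, zero_smul, zero_sub, norm_neg] using h3

/-- The local limit theorem for laws whose characteristic functions are close to the Gaussian one on
the zone `‖ξ‖ ≤ K * t n ^ ρ`, at every scale `t n ^ (-δ)` with `δ < ρ`. -/
lemma tendsto_rpow_mul_measureReal {Q : ℕ → Measure E} [∀ n, IsProbabilityMeasure (Q n)]
    {t : ℕ → ℝ} (ht_pos : ∀ n, 0 < t n) (ht : Tendsto t atTop atTop)
    {C v ρ K δ : ℝ} (hC : 0 ≤ C) (hv : 0 < v) (hK : 0 < K) (hδ : 0 < δ) (hδρ : δ < ρ)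
    (h : ∀ᶠ n in atTop, ∀ ξ, ‖ξ‖ ≤ K * t n ^ ρ →
      ‖charFun (Q n) ξ - (Real.exp (-‖ξ‖ ^ 2 / 2) : ℝ)‖ ≤
        C * (‖ξ‖ / √(t n)) ^ v * Real.exp (-‖ξ‖ ^ 2 / 4)) (y : E)
    {B : Set E} (hB : Bornology.IsBounded B) (hBm : MeasurableSet B)
    (hfr : volume (frontier B) = 0) :
    Tendsto (fun n ↦ t n ^ ((Module.finrank ℝ E : ℝ) * δ) *
        (Q n).real {x | x - y ∈ (t n ^ (-δ)) • B}) atTop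
      (𝓝 (Real.exp (-‖y‖ ^ 2 / 2) / (2 * Real.pi) ^ ((Module.finrank ℝ E : ℝ) / 2) *
        volume.real B)) := by
  -- the local limit theorem is vague convergence of the rescaled laws of `t n ^ δ • (Y n - y)`
  set φ : ℕ → E → E := fun n x ↦ (t n ^ δ) • (x - y) with hφ
  have hφc n : Continuous (φ n) := by fun_prop
  have hs n : 0 < t n ^ δ := Real.rpow_pos_of_pos (ht_pos n) δ
  have hprob n : IsProbabilityMeasure ((Q n).map (φ n)) :=
    Measure.isProbabilityMeasure_map (hφc n).aemeasurable
  have hpi : (((2 * Real.pi) ^ ((Module.finrank ℝ E : ℝ) / 2) : ℝ) : ℂ) ≠ 0 := by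
    exact_mod_cast (by positivity : (0 : ℝ) < (2 * Real.pi) ^ ((Module.finrank ℝ E : ℝ) / 2)).ne'
  have hvague (f : E → ℝ) (hf : Continuous f) (hfc : HasCompactSupport f) :=
    tendsto_integral_of_tendsto_gaussian_mul_char (Q := fun n ↦ (Q n).map (φ n))
      (M := fun n ↦ (t n ^ δ) ^ Module.finrank ℝ E) (fun n ↦ pow_pos (hs n) _)
      (m := Real.exp (-‖y‖ ^ 2 / 2)) (Real.exp_pos _) (fun η ↦ by
        have hlim := (tendsto_integral_gaussian_mul_cexp_mul_charFun ht hC hv hK hδ hδρ h η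
          y).const_mul (((2 * Real.pi) ^ ((Module.finrank ℝ E : ℝ) / 2) : ℝ) : ℂ)⁻¹
        rw [inv_mul_cancel_left₀ hpi] at hlim
        refine hlim.congr fun n ↦ ?_
        rw [← integral_gaussian_mul_cexp_rescaled_eq (hs n) η y,
          integral_map (hφc n).aemeasurable (Continuous.aestronglyMeasurable (by fun_prop))]) hf hfc
  have hfin := tendsto_measureReal_of_tendsto_integral (fun n ↦ (pow_pos (hs n) _).le)
    hvague hB hBm hfr
  refine hfin.congr fun n ↦ ?_
  congr 1
  · rw [mul_comm _ δ, Real.rpow_mul (ht_pos n).le, Real.rpow_natCast]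
  · rw [map_measureReal_apply (hφc n).measurable hBm]
    congr 1
    ext x
    rw [Set.mem_preimage, Set.mem_ofPred_eq, Real.rpow_neg (ht_pos n).le,
      Set.mem_smul_set_iff_inv_smul_mem₀ (inv_ne_zero (hs n).ne'), inv_inv]

end Limit

/-! ### From the residue to the characteristic function -/

section Residue

variable {d : ℕ}

lemma charFun_map_inv_sqrt_smul_eq_residue {Ω : Type*} [MeasurableSpace Ω] {P : Measure Ω}
    {X : Ω → EuclideanSpace ℝ (Fin d)} (hX : AEMeasurable X P) {T : ℝ} (hT : 0 < T)
    (ξ : EuclideanSpace ℝ (Fin d)) :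
    charFun (P.map fun ω ↦ (√T)⁻¹ • X ω) ξ =
      residue P X T ((√T)⁻¹ • ξ) * (Real.exp (-‖ξ‖ ^ 2 / 2) : ℝ) := by
  have h1 : T * ‖(√T)⁻¹ • ξ‖ ^ 2 / 2 = ‖ξ‖ ^ 2 / 2 := by
    rw [norm_smul, norm_inv, Real.norm_of_nonneg (Real.sqrt_nonneg T), mul_pow, inv_pow,
      Real.sq_sqrt hT.le, mul_inv_cancel_left₀ hT.ne']
  rw [residue, h1, mul_assoc, ← Complex.ofReal_mul, ← Real.exp_add, neg_div, add_neg_cancel,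
    Real.exp_zero, Complex.ofReal_one, mul_one, charFun_apply,
    integral_map (by fun_prop) (Continuous.aestronglyMeasurable (by fun_prop))]
  congr 1 with ω
  rw [mul_comm, real_inner_smul_left, real_inner_smul_left, real_inner_comm]

lemma mem_cube_of_norm_le {r : ℝ} {ξ : EuclideanSpace ℝ (Fin d)} (h : ‖ξ‖ ≤ r) : ξ ∈ cube d r :=
  fun i ↦ abs_le.1 ((PiLp.norm_apply_le ξ i).trans h)

/-- The zone of control for the residue of `X n`, read as an estimate for the characteristic function
of `X n / √(t n)`. The cube is replaced by a ball contained in it, whose radius carries a smaller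
constant `K'`, so that the factor `exp (K₂ ‖·‖ ^ w)` costs only half of the Gaussian exponent. -/
lemma exists_norm_charFun_sub_le {Ω : ℕ → Type*} [∀ n, MeasurableSpace (Ω n)]
    {P : (n : ℕ) → Measure (Ω n)} {X : (n : ℕ) → Ω n → EuclideanSpace ℝ (Fin d)}
    (hX : ∀ n, AEMeasurable (X n) (P n))
    {t : ℕ → ℝ} (ht_pos : ∀ n, 0 < t n) (ht : Tendsto t atTop atTop)
    {K K₁ K₂ v w γ : ℝ} (hK : 0 < K) (hw : 2 ≤ w) (hγw : 2 < w → γ ≤ 1 / (w - 2))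
    (hzone : ∀ n, ∀ ξ ∈ cube d (K * t n ^ γ),
      ‖residue (P n) (X n) (t n) ξ - 1‖ ≤ K₁ * ‖ξ‖ ^ v * Real.exp (K₂ * ‖ξ‖ ^ w)) :
    ∃ K', 0 < K' ∧ ∀ᶠ n in atTop, ∀ ξ, ‖ξ‖ ≤ K' * t n ^ (1 / 2 + γ) →
      ‖charFun ((P n).map fun ω ↦ (√(t n))⁻¹ • X n ω) ξ - (Real.exp (-‖ξ‖ ^ 2 / 2) : ℝ)‖ ≤
        |K₁| * (‖ξ‖ / √(t n)) ^ v * Real.exp (-‖ξ‖ ^ 2 / 4) := by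
  obtain ⟨K', hK', hK'K, hdom⟩ := exists_zone_mul_rpow_le (K₂ := K₂) hK hw hγw
  refine ⟨K', hK', ?_⟩
  filter_upwards [ht.eventually hdom] with n hn ξ hξ
  have hT := ht_pos n
  have hsq : 0 < √(t n) := Real.sqrt_pos.2 hT
  have hζ : ‖(√(t n))⁻¹ • ξ‖ = ‖ξ‖ / √(t n) := by
    rw [norm_smul, norm_inv, Real.norm_of_nonneg hsq.le, div_eq_inv_mul]
  have hζK : ‖ξ‖ / √(t n) ≤ K' * t n ^ γ := by
    rwa [div_le_iff₀ hsq, mul_assoc, Real.sqrt_eq_rpow, ← Real.rpow_add hT, add_comm γ]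
  have h1 := hzone n ((√(t n))⁻¹ • ξ)
    (mem_cube_of_norm_le (hζ.trans_le (hζK.trans (by gcongr))))
  have h2 := hn (‖ξ‖ / √(t n)) (by positivity) hζK
  rw [div_pow ‖ξ‖, Real.sq_sqrt hT.le, mul_div_cancel₀ _ hT.ne'] at h2
  rw [hζ] at h1
  rw [charFun_map_inv_sqrt_smul_eq_residue (hX n) hT, ← sub_one_mul, norm_mul, Complex.norm_real,
    Real.norm_of_nonneg (Real.exp_pos _).le]
  calc _ ≤ |K₁| * (‖ξ‖ / √(t n)) ^ v * Real.exp (‖ξ‖ ^ 2 / 4) * Real.exp (-‖ξ‖ ^ 2 / 2) := by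
        gcongr
        refine h1.trans ?_
        gcongr
        exact le_abs_self _
    _ = _ := by
        rw [mul_assoc, ← Real.exp_add]
        congr 2
        ring

end Residue

end ModGaussian

theorem proposition4p3 {d : ℕ} (hd : 1 ≤ d)
    {Ω : ℕ → Type*} [∀ n, MeasurableSpace (Ω n)]
    (P : (n : ℕ) → Measure (Ω n)) [∀ n, IsProbabilityMeasure (P n)]
    (X : (n : ℕ) → Ω n → EuclideanSpace ℝ (Fin d)) (hX : ∀ n, AEMeasurable (X n) (P n))
    (t : ℕ → ℝ) (ht_pos : ∀ n, 0 < t n) (ht : Tendsto t atTop atTop)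
    (K K₁ K₂ v w γ : ℝ) (hK : 0 < K) (hv : 0 < v) (hw : 2 ≤ w)
    (hγ : -(1 / 2) < γ)
    -- the upper bound `1 / (w - 2)` is read as `+∞` when `w = 2`
    (hγw : 2 < w → γ ≤ 1 / (w - 2))
    (hzone : ∀ n, ∀ ξ ∈ ModGaussian.cube d (K * t n ^ γ),
      ‖ModGaussian.residue (P n) (X n) (t n) ξ - 1‖ ≤ K₁ * ‖ξ‖ ^ v * Real.exp (K₂ * ‖ξ‖ ^ w)) :
    TendstoInDistribution (fun n ω ↦ (√(t n))⁻¹ • X n ω) atTop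
        (id : EuclideanSpace ℝ (Fin d) → EuclideanSpace ℝ (Fin d)) P
        (stdGaussian (EuclideanSpace ℝ (Fin d))) ∧
      ∀ δ ∈ Set.Ioo (0 : ℝ) (1 / 2 + γ), ∀ y : EuclideanSpace ℝ (Fin d),
        ∀ B : Set (EuclideanSpace ℝ (Fin d)), ModGaussian.IsJordanMeasurable B → 0 < volume B →
          Tendsto
            (fun n ↦ t n ^ ((d : ℝ) * δ) *
              (P n).real {ω | (√(t n))⁻¹ • X n ω - y ∈ (t n ^ (-δ)) • B})
            atTop
            (𝓝 (Real.exp (-‖y‖ ^ 2 / 2) / (2 * Real.pi) ^ ((d : ℝ) / 2) * volume.real B)) := by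
  obtain ⟨K', hK', hbound⟩ :=
    ModGaussian.exists_norm_charFun_sub_le hX ht_pos ht hK hw hγw hzone
  have hY n : AEMeasurable (fun ω ↦ (√(t n))⁻¹ • X n ω) (P n) := by have := hX n; fun_prop
  have hprob n : IsProbabilityMeasure ((P n).map fun ω ↦ (√(t n))⁻¹ • X n ω) :=
    Measure.isProbabilityMeasure_map (hY n)
  refine ⟨⟨hY, by fun_prop, ?_⟩, fun δ hδ y B hB _ ↦ ?_⟩
  · refine ProbabilityMeasure.tendsto_of_tendsto_charFun fun ξ ↦ ?_
    simp only [ProbabilityMeasure.coe_mk, Measure.map_id, charFun_stdGaussian]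
    have := ModGaussian.tendsto_charFun_of_norm_sub_le ht hv (by linarith) hK' hbound ξ
    simpa using this
  · have := ModGaussian.tendsto_rpow_mul_measureReal ht_pos ht (abs_nonneg K₁) hv hK' hδ.1 hδ.2
      hbound y hB.isBounded hB.measurableSet hB.volume_frontier
    rw [finrank_euclideanSpace_fin] at this
    refine this.congr fun n ↦ ?_
    congr 1
    refine map_measureReal_apply_of_aemeasurable (hY n) ?_
    exact measurable_id.sub_const y (hB.measurableSet.const_smul₀ _)
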